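/- Let $a\in\mathbb C$ with $-1<\Re(a)<0$ and let $\xi\in\mathbb R$. Then the integrals below converge absolutely and $$\int_{-\infty}^{\infty}\Gamma(a+it)\,\Gamma(a-it)\,e^{-i\xi t}\,dt =-\frac{\sqrt{\pi}\,\Gamma(a+1)\,\Gamma\left(a+\tfrac32\right)}{a} \left\{\cosh(a\xi)\int_0^{\infty}\frac{e^{as}}{\cosh^{2a+2}\left(\frac s2\right)}\,ds +\int_0^{\xi}\frac{\sinh\left(a(\xi-s)\right)}{\cosh^{2a+2}\left(\frac s2\right)}\,ds\right\},$$ where $\cosh^{2a+2}(s/2)=\exp\left((2a+2)\log\cosh(s/2)\right)$ with the real logarithm, and $\int_0^{\xi}=-\int_{\xi}^0$ if $\xi<0$. -/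

import Mathlib

open MeasureTheory

/-! The recurrence gives `Γ(a+it)Γ(a-it) = Γ(a+1+it)Γ(a+1-it) / ((a+it)(a-it))`, where `Re(a+1) >
0`. The numerator is a Beta integral, which a logistic substitution turns into the Fourier transform
of `W(s) = cosh(s/2)^(-2a-2)`, up to a constant (`Gamma_add_mul_Gamma_sub_eq_integral`). The
rational factor is the transform of a multiple of `e^(a|x|)`. Hence the integral is a convolution of
`e^(a|x|)` with `W` at `ξ` (`integral_fourier_mul_exp_mul_inv`). Evenness of `W` yields the
cosh/sinh form (`integral_exp_mul_abs_sub_mul`), and Legendre duplication the constant. -/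

/-! ### Beta integral in logistic coordinates -/

lemma sigmoid_eq_exp_div_cosh (s : ℝ) :
    Real.sigmoid s = Real.exp (s / 2) / (2 * Real.cosh (s / 2)) := by
  have h1 : Real.exp (-s) = Real.exp (-(s / 2)) * Real.exp (-(s / 2)) := by
    rw [← Real.exp_add]; ring_nf
  have h2 : Real.exp (s / 2) * Real.exp (-(s / 2)) = 1 := by rw [← Real.exp_add]; simp
  have h3 := Real.exp_pos (s / 2)
  have h4 := Real.exp_pos (-(s / 2))
  rw [Real.sigmoid_def, Real.cosh_eq, h1]
  field_simp
  linear_combination (-Real.exp (-(s / 2))) * h2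

lemma sigmoid_cpow_mul_cpow (u v : ℂ) (s : ℝ) :
    (Real.sigmoid s : ℂ) ^ u * (1 - (Real.sigmoid s : ℂ)) ^ v =
      Complex.exp ((u - v) / 2 * s) / ((2 * Real.cosh (s / 2) : ℝ) : ℂ) ^ (u + v) := by
  have hc : 0 < 2 * Real.cosh (s / 2) := by positivity
  have hp : ∀ (r : ℝ) (z : ℂ), ((Real.sigmoid r : ℝ) : ℂ) ^ z =
      Complex.exp (r / 2 * z) / ((2 * Real.cosh (r / 2) : ℝ) : ℂ) ^ z := by
    intro r z
    have hc : 0 < 2 * Real.cosh (r / 2) := by positivity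
    have hne : ((2 * Real.cosh (r / 2) : ℝ) : ℂ) ≠ 0 := by exact_mod_cast hc.ne'
    rw [Complex.cpow_def_of_ne_zero (by exact_mod_cast (Real.sigmoid_pos r).ne'),
      Complex.cpow_def_of_ne_zero hne, ← Complex.ofReal_log (Real.sigmoid_nonneg r),
      ← Complex.ofReal_log hc.le, sigmoid_eq_exp_div_cosh,
      Real.log_div (Real.exp_pos _).ne' hc.ne', Real.log_exp, ← Complex.exp_sub]
    congr 1
    push_cast
    ring
  have hn : (1 - (Real.sigmoid s : ℂ)) = ((Real.sigmoid (-s) : ℝ) : ℂ) := by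
    rw [Real.sigmoid_neg]; push_cast; rfl
  have hne : ((2 * Real.cosh (s / 2) : ℝ) : ℂ) ≠ 0 := by exact_mod_cast hc.ne'
  rw [hn, hp, hp, neg_div, Real.cosh_neg, div_mul_div_comm, ← Complex.exp_add,
    ← Complex.cpow_add _ _ hne]
  congr 2
  push_cast; ring

/-- Substitute `x = sigmoid s`, a bijection from the line onto `(0,1)`; its derivative `x(1-x)`
absorbs the `-1` in both Beta exponents. -/
lemma betaIntegral_eq_integral_cosh {u v : ℂ} (hu : 0 < u.re) (hv : 0 < v.re) :
    Integrable (fun s : ℝ => Complex.exp ((u - v) / 2 * s) /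
      ((2 * Real.cosh (s / 2) : ℝ) : ℂ) ^ (u + v)) ∧
    ∫ s : ℝ, Complex.exp ((u - v) / 2 * s) / ((2 * Real.cosh (s / 2) : ℝ) : ℂ) ^ (u + v) =
      Complex.betaIntegral u v := by
  set f : ℝ → ℂ := fun x => (x : ℂ) ^ (u - 1) * (1 - (x : ℂ)) ^ (v - 1) with hf
  have hint : IntegrableOn f (Set.Ioo 0 1) := by
    have := (Complex.betaIntegral_convergent hu hv)
    rw [intervalIntegrable_iff_integrableOn_Ioo_of_le zero_le_one] at this
    exact this
  have himg : Real.sigmoid '' Set.univ = Set.Ioo 0 1 := by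
    rw [Set.image_univ, Real.range_sigmoid]
  have hder : ∀ x ∈ (Set.univ : Set ℝ), HasDerivWithinAt Real.sigmoid
      (Real.sigmoid x * (1 - Real.sigmoid x)) Set.univ x :=
    fun x _ => (Real.hasDerivAt_sigmoid x).hasDerivWithinAt
  have hfun : ∀ s : ℝ, |Real.sigmoid s * (1 - Real.sigmoid s)| • f (Real.sigmoid s) =
      Complex.exp ((u - v) / 2 * s) / ((2 * Real.cosh (s / 2) : ℝ) : ℂ) ^ (u + v) := by
    intro s
    have h0 := Real.sigmoid_pos s
    have h1 : 0 < 1 - Real.sigmoid s := sub_pos.2 (Real.sigmoid_lt_one s)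
    have h0' : (Real.sigmoid s : ℂ) ≠ 0 := by exact_mod_cast h0.ne'
    have h1' : (1 - (Real.sigmoid s : ℂ)) ≠ 0 := by exact_mod_cast h1.ne'
    rw [← sigmoid_cpow_mul_cpow, abs_of_pos (mul_pos h0 h1), hf]
    simp only [Complex.real_smul]
    rw [Complex.cpow_sub _ _ h0', Complex.cpow_sub _ _ h1', Complex.cpow_one, Complex.cpow_one]
    push_cast
    field_simp
  constructor
  · rw [← himg, integrableOn_image_iff_integrableOn_abs_deriv_smul MeasurableSet.univ hder
      Real.sigmoid_injective.injOn, integrableOn_univ] at hint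
    simpa only [hfun] using hint
  · have := integral_image_eq_integral_abs_deriv_smul MeasurableSet.univ hder
      Real.sigmoid_injective.injOn f
    rw [himg, setIntegral_univ] at this
    simp only [hfun] at this
    rw [← this, Complex.betaIntegral, intervalIntegral.integral_of_le zero_le_one,
      integral_Ioc_eq_integral_Ioo]

/-! ### Fourier pair of the two-sided exponential -/

lemma add_I_mul_ne_zero {a : ℂ} (ha : a.re ≠ 0) (t : ℝ) : a + Complex.I * t ≠ 0 := by
  intro h
  apply ha
  simpa using congrArg Complex.re h

lemma sub_I_mul_ne_zero {a : ℂ} (ha : a.re ≠ 0) (t : ℝ) : a - Complex.I * t ≠ 0 := by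
  simpa [sub_eq_add_neg] using add_I_mul_ne_zero ha (-t)

lemma integrable_inv_sq_add_shift_sq {x : ℝ} (hx : x ≠ 0) (y : ℝ) :
    Integrable (fun t : ℝ => (x ^ 2 + (y + t) ^ 2)⁻¹) := by
  have h := ((integrable_inv_one_add_sq.comp_div hx).const_mul (x ^ 2)⁻¹).comp_add_left y
  refine h.congr (Filter.Eventually.of_forall fun t => ?_)
  have : x ^ 2 + (y + t) ^ 2 ≠ 0 := by positivity
  simp only
  rw [← mul_inv]
  congr 1
  field_simp

lemma integrable_inv_add_I_mul_sub_I_mul {a : ℂ} (ha : a.re ≠ 0) :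
    Integrable (fun t : ℝ => ((a + Complex.I * t) * (a - Complex.I * t))⁻¹) := by
  have hc : Continuous (fun t : ℝ => ((a + Complex.I * t) * (a - Complex.I * t))⁻¹) :=
    Continuous.inv₀ (by fun_prop)
      fun t => mul_ne_zero (add_I_mul_ne_zero ha t) (sub_I_mul_ne_zero ha t)
  have h2 : Integrable (fun t : ℝ => (a.re ^ 2 + (-a.im + t) ^ 2)⁻¹) :=
    integrable_inv_sq_add_shift_sq ha _
  refine ((integrable_inv_sq_add_shift_sq ha a.im).add h2).mono' hc.aestronglyMeasurable
    (Filter.Eventually.of_forall fun t => ?_)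
  have e1 : a.re ^ 2 + (a.im + t) ^ 2 = ‖a + Complex.I * t‖ ^ 2 := by
    rw [Complex.sq_norm, Complex.normSq_apply]; simp; ring
  have e2 : a.re ^ 2 + (-a.im + t) ^ 2 = ‖a - Complex.I * t‖ ^ 2 := by
    rw [Complex.sq_norm, Complex.normSq_apply]; simp; ring
  simp only [Pi.add_apply]
  rw [e1, e2, norm_inv, norm_mul, mul_inv, ← inv_pow, ← inv_pow]
  -- `xy ≤ x² + y²` for the two inverse norms.
  nlinarith [sq_nonneg (‖a + Complex.I * t‖⁻¹ - ‖a - Complex.I * t‖⁻¹),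
    sq_nonneg (‖a + Complex.I * t‖⁻¹), sq_nonneg (‖a - Complex.I * t‖⁻¹)]

lemma integral_exp_mul_abs_mul_exp {a : ℂ} (ha : a.re < 0) (t : ℝ) :
    Integrable (fun x : ℝ => Complex.exp (a * |x|) * Complex.exp (Complex.I * t * x)) ∧
    ∫ x : ℝ, Complex.exp (a * |x|) * Complex.exp (Complex.I * t * x) =
      -2 * a * ((a + Complex.I * t) * (a - Complex.I * t))⁻¹ := by
  have h1 : (a + Complex.I * t).re < 0 := by simpa
  have h2 : 0 < (-a + Complex.I * t).re := by simpa
  have e1 : Set.EqOn (fun x : ℝ => Complex.exp ((a + Complex.I * t) * x))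
      (fun x : ℝ => Complex.exp (a * |x|) * Complex.exp (Complex.I * t * x)) (Set.Ioi 0) := by
    intro x hx
    simp only [abs_of_pos (Set.mem_Ioi.1 hx)]
    rw [← Complex.exp_add]; ring_nf
  have e2 : Set.EqOn (fun x : ℝ => Complex.exp ((-a + Complex.I * t) * x))
      (fun x : ℝ => Complex.exp (a * |x|) * Complex.exp (Complex.I * t * x)) (Set.Iic 0) := by
    intro x hx
    simp only [abs_of_nonpos (Set.mem_Iic.1 hx)]
    rw [← Complex.exp_add]; push_cast; ring_nf
  have i1 := (integrableOn_exp_mul_complex_Ioi h1 0).congr_fun e1 measurableSet_Ioi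
  have i2 := (integrableOn_exp_mul_complex_Iic h2 0).congr_fun e2 measurableSet_Iic
  refine ⟨?_, ?_⟩
  · rw [← integrableOn_univ, ← Set.Iic_union_Ioi (a := (0 : ℝ))]
    exact i2.union i1
  · rw [← intervalIntegral.integral_Iic_add_Ioi i2 i1,
      ← setIntegral_congr_fun measurableSet_Ioi e1, ← setIntegral_congr_fun measurableSet_Iic e2,
      integral_exp_mul_complex_Ioi h1, integral_exp_mul_complex_Iic h2]
    have n1 := add_I_mul_ne_zero ha.ne t
    have n2 := sub_I_mul_ne_zero ha.ne t
    have : -a + Complex.I * t = -(a - Complex.I * t) := by ring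
    rw [this]
    simp only [Complex.ofReal_zero, mul_zero, Complex.exp_zero]
    field_simp
    ring

/-- Fourier inversion for the continuous integrable function `e^(a|x|)`, whose transform is
integrable. The rescaling `t = -2πw` matches Mathlib's normalization. -/
lemma integral_exp_mul_inv_add_I_mul_sub_I_mul {a : ℂ} (ha : a.re < 0) (x : ℝ) :
    ∫ t : ℝ, Complex.exp (-Complex.I * x * t) * ((a + Complex.I * t) * (a - Complex.I * t))⁻¹ =
      -(Real.pi / a) * Complex.exp (a * |x|) := by
  have ha0 : a ≠ 0 := by rintro rfl; simp at ha
  set h : ℝ → ℂ := fun x => Complex.exp (a * |x|) with hh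
  have hcont : Continuous h := by fun_prop
  have hint : Integrable h := by simpa using (integral_exp_mul_abs_mul_exp ha 0).1
  have hF : FourierTransform.fourier h = fun w : ℝ =>
      (fun t : ℝ => -2 * a * ((a + Complex.I * t) * (a - Complex.I * t))⁻¹)
        ((-(2 * Real.pi)) * w) := by
    ext w
    refine Eq.trans ?_ (integral_exp_mul_abs_mul_exp ha _).2
    rw [Real.fourier_eq']
    congr 1; ext v
    rw [smul_eq_mul, mul_comm]
    congr 2
    simp
    ring
  have h2pi : (-(2 * Real.pi)) ≠ 0 := by have := Real.pi_pos; linarith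
  have hFint : Integrable (FourierTransform.fourier h) := by
    rw [hF]
    exact ((integrable_inv_add_I_mul_sub_I_mul ha.ne).const_mul (-2 * a)).comp_mul_left' h2pi
  have inv := congrFun (hcont.fourierInv_fourier_eq hint hFint) x
  rw [Real.fourierInv_eq', hF] at inv
  have key := Measure.integral_comp_mul_left (fun t : ℝ => Complex.exp (-Complex.I * x * t) *
    (-2 * a * ((a + Complex.I * t) * (a - Complex.I * t))⁻¹)) (-(2 * Real.pi))
  have e : ∫ v : ℝ, Complex.exp (((2 * Real.pi * inner ℝ v x : ℝ) : ℂ) * Complex.I) •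
      (fun t : ℝ => -2 * a * ((a + Complex.I * t) * (a - Complex.I * t))⁻¹)
        ((-(2 * Real.pi)) * v) = Complex.exp (a * |x|) := inv
  have e' : (fun v : ℝ => Complex.exp (((2 * Real.pi * inner ℝ v x : ℝ) : ℂ) * Complex.I) •
      (fun t : ℝ => -2 * a * ((a + Complex.I * t) * (a - Complex.I * t))⁻¹)
        ((-(2 * Real.pi)) * v)) = fun v : ℝ => (fun t : ℝ => Complex.exp (-Complex.I * x * t) *
    (-2 * a * ((a + Complex.I * t) * (a - Complex.I * t))⁻¹)) (-(2 * Real.pi) * v) := by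
    ext v
    simp only [smul_eq_mul]
    congr 2
    simp
    ring
  rw [e', key] at e
  rw [← e]
  have : ∀ t : ℝ, Complex.exp (-Complex.I * x * t) *
    (-2 * a * ((a + Complex.I * t) * (a - Complex.I * t))⁻¹) = (-2 * a) *
     (Complex.exp (-Complex.I * x * t) * ((a + Complex.I * t) * (a - Complex.I * t))⁻¹) := by
    intro t; ring
  simp only [this]
  rw [integral_const_mul, abs_inv, abs_neg, abs_of_pos (by positivity), Complex.real_smul]
  have hpi : (Real.pi : ℂ) ≠ 0 := by exact_mod_cast Real.pi_ne_zero
  push_cast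
  field_simp

/-! ### Gamma products as transforms of powers of cosh -/

lemma ofReal_cosh_half_ne_zero (s : ℝ) : ((Real.cosh (s / 2) : ℝ) : ℂ) ≠ 0 := by
  exact_mod_cast (Real.cosh_pos _).ne'

lemma two_mul_cosh_cpow (c : ℂ) (s : ℝ) :
    ((2 * Real.cosh (s / 2) : ℝ) : ℂ) ^ c = 2 ^ c * ((Real.cosh (s / 2) : ℝ) : ℂ) ^ c := by
  rw [Complex.ofReal_mul, Complex.mul_cpow_ofReal_nonneg (by norm_num) (Real.cosh_pos _).le]
  norm_num

lemma integrable_inv_cosh_cpow {c : ℂ} (hc : 0 < c.re) :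
    Integrable (fun s : ℝ => (((Real.cosh (s / 2) : ℝ) : ℂ) ^ c)⁻¹) := by
  have hc2 : 0 < (c / 2).re := by
    rw [Complex.div_ofNat_re]; positivity
  -- Equal parameters `u = v = c/2` kill the exponential factor.
  have h := ((betaIntegral_eq_integral_cosh hc2 hc2).1).const_mul (2 ^ c)
  refine h.congr (Filter.Eventually.of_forall fun s => ?_)
  have h2 : (2 : ℂ) ^ c ≠ 0 := by simp [Complex.cpow_eq_zero_iff]
  have h3 : ((Real.cosh (s / 2) : ℝ) : ℂ) ^ c ≠ 0 := by
    rw [Ne, Complex.cpow_eq_zero_iff]; exact fun h => ofReal_cosh_half_ne_zero s h.1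
  simp only [add_halves, sub_self, zero_div, zero_mul, Complex.exp_zero, two_mul_cosh_cpow]
  field_simp

lemma Gamma_add_mul_Gamma_sub_eq_integral {b : ℂ} (hb : 0 < b.re) (t : ℝ) :
    Complex.Gamma (b + Complex.I * t) * Complex.Gamma (b - Complex.I * t) =
      Complex.Gamma (2 * b) * 2 ^ (-(2 * b)) *
        ∫ s : ℝ, Complex.exp (Complex.I * t * s) * (((Real.cosh (s / 2) : ℝ) : ℂ) ^ (2 * b))⁻¹ := by
  have hu : 0 < (b + Complex.I * t).re := by simpa
  have hv : 0 < (b - Complex.I * t).re := by simpa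
  have h1 : b + Complex.I * t + (b - Complex.I * t) = 2 * b := by ring
  have h2 : (b + Complex.I * t - (b - Complex.I * t)) / 2 = Complex.I * t := by ring
  rw [Complex.Gamma_mul_Gamma_eq_betaIntegral hu hv, ← (betaIntegral_eq_integral_cosh hu hv).2,
    h1, h2, mul_assoc, ← integral_const_mul (2 ^ (-(2 * b)))]
  congr 1
  refine integral_congr_ae (Filter.Eventually.of_forall fun s => ?_)
  simp only
  rw [two_mul_cosh_cpow, Complex.cpow_neg]
  field_simp

/-! ### Convolution with the two-sided exponential -/

lemma integrableOn_bounded_mul {g W : ℝ → ℂ} {S : Set ℝ} (hS : MeasurableSet S)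
    (hg : Continuous g) {C : ℝ} (hC : ∀ s ∈ S, ‖g s‖ ≤ C) (hW : Integrable W) :
    IntegrableOn (fun s => g s * W s) S :=
  hW.integrableOn.bdd_mul hg.aestronglyMeasurable ((ae_restrict_iff' hS).2
    (Filter.Eventually.of_forall hC))

lemma integrableOn_Ioi_exp_mul {a : ℂ} (ha : a.re < 0) {W : ℝ → ℂ} (hW : Integrable W) (c : ℝ) :
    IntegrableOn (fun s : ℝ => Complex.exp (a * s) * W s) (Set.Ioi c) := by
  refine integrableOn_bounded_mul (C := Real.exp (a.re * c)) measurableSet_Ioi (by fun_prop)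
    (fun s hs => ?_) hW
  rw [Complex.norm_exp, Real.exp_le_exp]
  simpa using mul_le_mul_of_nonpos_left (Set.mem_Ioi.1 hs).le ha.le

/-- Cut at `s = ξ`, then move the cut to `0`. By evenness the half-line pieces are `e^(±aξ)` times
one common integral and add up to the cosh term; the corrections between `0` and `ξ` form the sinh
term, whatever the sign of `ξ`. -/
lemma integral_exp_mul_abs_sub_mul {a : ℂ} (ha : a.re < 0) {W : ℝ → ℂ} (hW : Integrable W)
    (heven : ∀ s, W (-s) = W s) (ξ : ℝ) :
    ∫ s : ℝ, Complex.exp (a * |ξ - s|) * W s =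
      2 * (Complex.cosh (a * ξ) * (∫ s in Set.Ioi (0 : ℝ), Complex.exp (a * s) * W s) +
        ∫ s in (0 : ℝ)..ξ, Complex.sinh (a * (ξ - s)) * W s) := by
  set P : ℝ → ℂ := fun s => Complex.exp (a * (ξ - s)) * W s with hP
  set Q : ℝ → ℂ := fun s => Complex.exp (-(a * (ξ - s))) * W s with hQ
  have hQint : ∀ c, IntegrableOn Q (Set.Ioi c) := by
    intro c
    refine IntegrableOn.congr_fun ((integrableOn_Ioi_exp_mul ha hW c).const_mul
      (Complex.exp (-(a * ξ)))) (fun s _ => ?_) measurableSet_Ioi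
    simp only [hQ]
    rw [← mul_assoc, ← Complex.exp_add]; ring_nf
  have hPint : ∀ c, IntegrableOn P (Set.Iic c) := by
    intro c
    refine integrableOn_bounded_mul (C := Real.exp (a.re * (ξ - c))) measurableSet_Iic
      (by fun_prop) (fun s hs => ?_) hW
    rw [Complex.norm_exp, Real.exp_le_exp]
    simpa using mul_le_mul_of_nonpos_left (sub_le_sub_left (Set.mem_Iic.1 hs) ξ) ha.le
  have hPi : IntervalIntegrable P volume 0 ξ :=
    hW.intervalIntegrable.continuousOn_mul (by fun_prop)
  have hQi : IntervalIntegrable Q volume 0 ξ :=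
    hW.intervalIntegrable.continuousOn_mul (by fun_prop)
  have e1 : Set.EqOn P (fun s : ℝ => Complex.exp (a * |ξ - s|) * W s) (Set.Iic ξ) := by
    intro s hs
    simp only [hP, abs_of_nonneg (sub_nonneg.2 (Set.mem_Iic.1 hs))]
    push_cast; rfl
  have e2 : Set.EqOn Q (fun s : ℝ => Complex.exp (a * |ξ - s|) * W s) (Set.Ioi ξ) := by
    intro s hs
    simp only [hQ, abs_of_neg (sub_neg.2 (Set.mem_Ioi.1 hs))]
    push_cast; ring_nf
  have hP0 : ∫ s in Set.Iic (0 : ℝ), P s =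
      Complex.exp (a * ξ) * ∫ s in Set.Ioi (0 : ℝ), Complex.exp (a * s) * W s := by
    rw [← neg_zero, ← integral_comp_neg_Ioi, ← integral_const_mul]
    simp only [neg_zero]
    congr 1; ext s
    simp only [hP, heven]
    rw [← mul_assoc, ← Complex.exp_add]; push_cast; ring_nf
  have hQ0 : ∫ s in Set.Ioi (0 : ℝ), Q s =
      Complex.exp (-(a * ξ)) * ∫ s in Set.Ioi (0 : ℝ), Complex.exp (a * s) * W s := by
    rw [← integral_const_mul]
    congr 1; ext s
    simp only [hQ]
    rw [← mul_assoc, ← Complex.exp_add]; ring_nf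
  have hdiff : 2 * ∫ s in (0 : ℝ)..ξ, Complex.sinh (a * (ξ - s)) * W s =
      (∫ s in (0 : ℝ)..ξ, P s) - ∫ s in (0 : ℝ)..ξ, Q s := by
    rw [← intervalIntegral.integral_sub hPi hQi, ← intervalIntegral.integral_const_mul]
    congr 1; ext s
    simp only [hP, hQ, Complex.sinh]
    ring
  have h1 := intervalIntegral.integral_Iic_sub_Iic (hPint 0) (hPint ξ)
  have h2 := intervalIntegral.integral_interval_add_Ioi (hQint 0) (hQint ξ)
  rw [← intervalIntegral.integral_Iic_add_Ioi ((hPint ξ).congr_fun e1 measurableSet_Iic)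
    ((hQint ξ).congr_fun e2 measurableSet_Ioi), ← setIntegral_congr_fun measurableSet_Iic e1,
    ← setIntegral_congr_fun measurableSet_Ioi e2, mul_add, hdiff, ← h1, hP0, Complex.cosh]
  linear_combination h2 + hQ0

lemma integral_fourier_mul_exp_mul_inv {a : ℂ} (ha : a.re < 0) {W : ℝ → ℂ} (hW : Integrable W)
    (ξ : ℝ) :
    ∫ t : ℝ, (∫ s : ℝ, Complex.exp (Complex.I * t * s) * W s) *
        (Complex.exp (-Complex.I * ξ * t) * ((a + Complex.I * t) * (a - Complex.I * t))⁻¹) =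
      -(Real.pi / a) * ∫ s : ℝ, Complex.exp (a * |ξ - s|) * W s := by
  set G : ℝ → ℂ := fun t => ((a + Complex.I * t) * (a - Complex.I * t))⁻¹ with hG
  have hGi : Integrable G := integrable_inv_add_I_mul_sub_I_mul ha.ne
  have hint : Integrable (Function.uncurry fun t s : ℝ =>
      Complex.exp (-Complex.I * ((ξ - s : ℝ) : ℂ) * t) * (G t * W s)) (volume.prod volume) := by
    refine (hGi.mul_prod hW).bdd_mul (c := 1)
      (Continuous.aestronglyMeasurable (by fun_prop)) (Filter.Eventually.of_forall fun p => ?_)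
    rw [Complex.norm_exp]
    simp
  calc _ = ∫ t : ℝ, ∫ s : ℝ, Complex.exp (-Complex.I * ((ξ - s : ℝ) : ℂ) * t) * (G t * W s) := by
        congr 1; ext t
        rw [← integral_mul_const]
        congr 1; ext s
        have : Complex.exp (-Complex.I * ((ξ - s : ℝ) : ℂ) * t) =
            Complex.exp (Complex.I * t * s) * Complex.exp (-Complex.I * ξ * t) := by
          rw [← Complex.exp_add]; push_cast; ring_nf
        rw [this]; ring
    _ = ∫ s : ℝ, ∫ t : ℝ, Complex.exp (-Complex.I * ((ξ - s : ℝ) : ℂ) * t) * (G t * W s) :=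
        integral_integral_swap hint
    _ = _ := by
        rw [← integral_const_mul]
        congr 1; ext s
        rw [← mul_assoc, ← integral_exp_mul_inv_add_I_mul_sub_I_mul ha, ← integral_mul_const]
        simp only [hG, mul_assoc]

/-- With the next bound, this makes the transform of `W` a bounded measurable multiplier, so the
rational factor alone ensures integrability in `t`. -/
lemma continuous_integral_exp_mul {W : ℝ → ℂ} (hW : Integrable W) :
    Continuous fun t : ℝ => ∫ s : ℝ, Complex.exp (Complex.I * t * s) * W s := by
  refine continuous_of_dominated (bound := fun s => ‖W s‖) (fun t => ?_)
    (fun t => Filter.Eventually.of_forall fun s => ?_) hW.norm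
    (Filter.Eventually.of_forall fun s => by fun_prop)
  · exact (Continuous.aestronglyMeasurable (by fun_prop)).mul hW.aestronglyMeasurable
  · simp [Complex.norm_exp]

lemma norm_integral_exp_mul_le (W : ℝ → ℂ) (t : ℝ) :
    ‖∫ s : ℝ, Complex.exp (Complex.I * t * s) * W s‖ ≤ ∫ s : ℝ, ‖W s‖ := by
  refine (norm_integral_le_integral_norm _).trans_eq ?_
  simp [Complex.norm_exp]

theorem theorem2 (a : ℂ) (ha : -1 < a.re) (ha' : a.re < 0) (ξ : ℝ) :
    Integrable (fun t : ℝ =>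
      Complex.Gamma (a + Complex.I * t) * Complex.Gamma (a - Complex.I * t) *
        Complex.exp (-Complex.I * ξ * t)) ∧
    IntegrableOn (fun s : ℝ =>
      Complex.exp (a * s) / ((Real.cosh (s / 2) : ℝ) : ℂ) ^ (2 * a + 2)) (Set.Ioi 0) ∧
    IntervalIntegrable (fun s : ℝ =>
      Complex.sinh (a * (ξ - s)) / ((Real.cosh (s / 2) : ℝ) : ℂ) ^ (2 * a + 2)) volume 0 ξ ∧
    ∫ t : ℝ, Complex.Gamma (a + Complex.I * t) * Complex.Gamma (a - Complex.I * t) *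
        Complex.exp (-Complex.I * ξ * t) =
      -((√Real.pi : ℝ) : ℂ) * Complex.Gamma (a + 1) * Complex.Gamma (a + 3 / 2) / a *
        (Complex.cosh (a * ξ) *
            (∫ s in Set.Ioi (0 : ℝ),
              Complex.exp (a * s) / ((Real.cosh (s / 2) : ℝ) : ℂ) ^ (2 * a + 2)) +
          ∫ s in (0 : ℝ)..ξ,
            Complex.sinh (a * (ξ - s)) / ((Real.cosh (s / 2) : ℝ) : ℂ) ^ (2 * a + 2)) := by
  set W : ℝ → ℂ := fun s => (((Real.cosh (s / 2) : ℝ) : ℂ) ^ (2 * a + 2))⁻¹ with hWdef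
  have hW : Integrable W := integrable_inv_cosh_cpow (by simp; linarith)
  have heven : ∀ s, W (-s) = W s := fun s => by simp [hWdef, neg_div]
  set K : ℂ := Complex.Gamma (2 * (a + 1)) * 2 ^ (-(2 * (a + 1))) with hK
  have hfun : (fun t : ℝ => Complex.Gamma (a + Complex.I * t) * Complex.Gamma (a - Complex.I * t) *
        Complex.exp (-Complex.I * ξ * t)) = fun t : ℝ =>
      K * ((∫ s : ℝ, Complex.exp (Complex.I * t * s) * W s) *
        (Complex.exp (-Complex.I * ξ * t) *
          ((a + Complex.I * t) * (a - Complex.I * t))⁻¹)) := by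
    ext t
    have h := Gamma_add_mul_Gamma_sub_eq_integral (b := a + 1) (by simp; linarith) t
    have n1 := add_I_mul_ne_zero ha'.ne t
    have n2 := sub_I_mul_ne_zero ha'.ne t
    rw [show a + 1 + Complex.I * t = a + Complex.I * t + 1 by ring,
      show a + 1 - Complex.I * t = a - Complex.I * t + 1 by ring,
      Complex.Gamma_add_one _ n1, Complex.Gamma_add_one _ n2, ← hK,
      show 2 * (a + 1) = 2 * a + 2 by ring] at h
    rw [← mul_assoc, ← h]
    field_simp
  refine ⟨?_, ?_, ?_, ?_⟩
  · rw [hfun]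
    have hG : Integrable fun t : ℝ => Complex.exp (-Complex.I * ξ * t) *
        ((a + Complex.I * t) * (a - Complex.I * t))⁻¹ :=
      (integrable_inv_add_I_mul_sub_I_mul ha'.ne).bdd_mul (c := 1)
        (Continuous.aestronglyMeasurable (by fun_prop))
        (Filter.Eventually.of_forall fun t => by simp [Complex.norm_exp])
    exact (hG.bdd_mul (continuous_integral_exp_mul hW).aestronglyMeasurable
      (Filter.Eventually.of_forall (norm_integral_exp_mul_le W))).const_mul K
  · simp only [div_eq_mul_inv _ ((_ : ℂ) ^ (2 * a + 2))]
    exact integrableOn_Ioi_exp_mul ha' hW 0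
  · simp only [div_eq_mul_inv _ ((_ : ℂ) ^ (2 * a + 2))]
    exact hW.intervalIntegrable.continuousOn_mul (Continuous.continuousOn (by fun_prop))
  · simp only [div_eq_mul_inv _ ((_ : ℂ) ^ (2 * a + 2))]
    rw [hfun, integral_const_mul, integral_fourier_mul_exp_mul_inv ha' hW,
      integral_exp_mul_abs_sub_mul ha' hW heven]
    -- Duplication at `a + 1` rewrites `Γ(2a+2)`; one `√π` from it and one from the statement make
    -- the `π` of Fourier inversion.
    have hdup := Complex.Gamma_mul_Gamma_add_half (a + 1)
    rw [show a + 1 + 1 / 2 = a + 3 / 2 by ring] at hdup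
    have hsq : ((√Real.pi : ℝ) : ℂ) * ((√Real.pi : ℝ) : ℂ) = Real.pi := by
      rw [← Complex.ofReal_mul, Real.mul_self_sqrt Real.pi_pos.le]
    have hpow : (2 : ℂ) ^ (1 - 2 * (a + 1)) = 2 * 2 ^ (-(2 * (a + 1))) := by
      rw [sub_eq_add_neg, Complex.cpow_add _ _ two_ne_zero, Complex.cpow_one]
    rw [hpow] at hdup
    have hconst : -((√Real.pi : ℝ) : ℂ) * Complex.Gamma (a + 1) * Complex.Gamma (a + 3 / 2) / a =
        K * (-(Real.pi / a) * 2) := by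
      rw [mul_assoc (-_) _ _, hdup, ← hsq, hK]
      ring
    rw [hconst]
    ring
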